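/- Setting. Let $E$ be a locally compact Hausdorff space with a countable base and its Borel $\sigma$-algebra. A Feller–Dynkin semigroup on $E$ is a strongly continuous semigroup $(\hat P_t)_{t\ge 0}$ of bounded linear operators on $C_0(E)$ with $0\le f\le 1\Rightarrow 0\le \hat P_t f\le 1$; let $P_t(x,\cdot)$ be the measures on $E$ with $\hat P_t f(x)=\int f(y)\,P_t(x,dy)$ for all $f\in C_0(E)$. A diffusion is such a semigroup that is honest ($P_t(x,E)=1$ for all $t,x$), together with probability measures $\mathbb P^x$ ($x\in E$) on the space $\Omega$ of continuous trajectories $\omega:[0,\infty)\to E$, equipped with the compact-open topology and the $\sigma$-algebra generated by the evaluations $\omega\mapsto\omega(t)$, such that for all $n$, all $0\le t_1\le\dots\le t_n$ and all Borel sets $C_0,\dots,C_n$, $$\mathbb P^x(\omega(0)\in C_0,\ \omega(t_1)\in C_1,\dots,\omega(t_n)\in C_n)=\mathbf 1_{C_0}(x)\int_{C_1}P_{t_1}(x,dx_1)\cdots\int_{C_n}P_{t_n-t_{n-1}}(x_{n-1},dx_n),$$ and such that $x\mapsto\int f\,d\mathbb P^x$ is continuous for every bounded continuous $f:\Omega\to\mathbb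 R$. Let $\mathcal P$ (respectively $\mathcal C$) be the set of pseudometrics $m:E\times E\to[0,1]$ that are lower semicontinuous (respectively continuous) for the topology of $E$; so $\mathcal C\subset\mathcal P$. For $0<c<1$, $m\in\mathcal P$ and $x,y\in E$ put $$U_c(m)(\omega,\omega')=\sup_{t\ge 0}c^t\,m(\omega(t),\omega'(t)),\qquad \mathcal G_c(m)(x,y)=W(U_c(m))(\mathbb P^x,\mathbb P^y)=\inf_{\gamma\in\Gamma(\mathbb P^x,\mathbb P^y)}\int U_c(m)\,d\gamma ,$$ where $\Gamma(\mathbb P^x,\mathbb P^y)$ is the set of couplings of $\mathbb P^x$ and $\mathbb P^y$. Theorem. Let a diffusion on $E$, a continuous function $obs:E\to[0,1]$ and $0<c<1$ be given, and define $d^c_0(x,y)=|obs(x)-obs(y)|$, $d^c_{n+1}=\mathcal G_c(d^c_n)$ and $\overline d^c=\sup_n d^c_n$. Then $d^c_n\in\mathcal C$ for every $n$ (so that the sequence is well defined), $\overline d^c\in\mathcal P$, and $\overline d^c$ is a fixpoint of $\mathcal G_c$: $\mathcal G_c(\overline d^c)=\overline d^c$. -/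

import Mathlib

open MeasureTheory Filter Topology
open scoped NNReal ENNReal ZeroAtInfty CompactlySupported BoundedContinuousFunction

noncomputable section

/-! ### Couplings and optimal transport cost -/

/-- The couplings of two measures: measures on the product with the given marginals.
(If one of the marginals is a probability measure, so is every coupling.) -/
def couplings {X Y : Type*} [MeasurableSpace X] [MeasurableSpace Y]
    (P : Measure X) (Q : Measure Y) : Set (Measure (X × Y)) :=
  {γ | γ.map Prod.fst = P ∧ γ.map Prod.snd = Q}

/-- The optimal transport cost `W(k)(P, Q)`, the infimum of `∫ k dγ` over all couplings `γ`. -/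
def transportCost {X : Type*} [MeasurableSpace X] (k : X → X → ℝ) (P Q : Measure X) : ℝ :=
  sInf {r : ℝ | ∃ γ ∈ couplings P Q, r = ∫ p, k p.1 p.2 ∂γ}

/-! ### The lattices of 1-bounded pseudometrics -/

/-- `m` is a 1-bounded pseudometric (no relation to a topology is required). -/
structure IsBddPseudometric {E : Type*} (m : E → E → ℝ) : Prop where
  nonneg : ∀ x y, 0 ≤ m x y
  le_one : ∀ x y, m x y ≤ 1
  self : ∀ x, m x x = 0
  symm : ∀ x y, m x y = m y x
  triangle : ∀ x y z, m x z ≤ m x y + m y z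

/-- The lattice of lower semicontinuous 1-bounded pseudometrics. -/
structure IsLscPseudometric {E : Type*} [TopologicalSpace E] (m : E → E → ℝ) : Prop extends
    IsBddPseudometric m where
  lsc : LowerSemicontinuous fun p : E × E => m p.1 p.2

/-- The lattice of continuous 1-bounded pseudometrics. -/
structure IsContPseudometric {E : Type*} [TopologicalSpace E] (m : E → E → ℝ) : Prop extends
    IsBddPseudometric m where
  cont : Continuous fun p : E × E => m p.1 p.2

/-! ### Feller-Dynkin semigroups and their kernels -/

/-- A Feller-Dynkin semigroup: a strongly continuous sub-Markov semigroup of bounded linear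
operators on `C₀(E)`. -/
structure FDSemigroup (E : Type*) [TopologicalSpace E] where
  op : ℝ≥0 → C₀(E, ℝ) →L[ℝ] C₀(E, ℝ)
  op_zero : op 0 = ContinuousLinearMap.id ℝ C₀(E, ℝ)
  op_add : ∀ s t, op (s + t) = (op s).comp (op t)
  strongly_continuous : ∀ f, Tendsto (fun t => op t f) (𝓝[>] 0) (𝓝 f)
  sub_markov : ∀ t f, (∀ x, 0 ≤ f x ∧ f x ≤ 1) → ∀ x, 0 ≤ op t f x ∧ op t f x ≤ 1

namespace FDSemigroup

variable {E : Type*} [TopologicalSpace E] (S : FDSemigroup E)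

theorem op_nonneg (t : ℝ≥0) (f : C₀(E, ℝ)) (hf : ∀ x, 0 ≤ f x) (x : E) : 0 ≤ S.op t f x := by
  have hb : ∀ y, f y ≤ ‖f‖ := fun y =>
    (le_abs_self _).trans ((f.toBCF.norm_coe_le_norm y))
  have hpos : 0 < ‖f‖ + 1 := by positivity
  have h := (S.sub_markov t ((‖f‖ + 1)⁻¹ • f) (fun y => by
    refine ⟨?_, ?_⟩
    · simpa using mul_nonneg (inv_nonneg.2 hpos.le) (hf y)
    · have : (‖f‖ + 1)⁻¹ * f y ≤ 1 := by
        rw [inv_mul_le_iff₀ hpos]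
        linarith [hb y]
      simpa using this) x).1
  rw [map_smul] at h
  have h' : 0 ≤ (‖f‖ + 1)⁻¹ * S.op t f x := by simpa using h
  exact nonneg_of_mul_nonneg_right h' (inv_pos.2 hpos)

/-- A compactly supported continuous function, regarded as an element of `C₀(E)`. -/
def ofCompSupp (f : C_c(E, ℝ)) : C₀(E, ℝ) := (f : C₀(E, ℝ))

/-- The positive linear functional `f ↦ (P̂_t f)(x)` on `C_c(E)`. -/
def functional (t : ℝ≥0) (x : E) : C_c(E, ℝ) →ₚ[ℝ] ℝ :=
  PositiveLinearMap.mk₀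
    { toFun := fun f => S.op t (ofCompSupp f) x
      map_add' := fun f g => by
        have : ofCompSupp (f + g) = ofCompSupp f + ofCompSupp g := by
          ext; rfl
        rw [this, map_add]; rfl
      map_smul' := fun r f => by
        have : ofCompSupp (r • f) = r • ofCompSupp f := by
          ext; rfl
        rw [this, map_smul]; rfl }
    (fun f hf => S.op_nonneg t (ofCompSupp f) (fun y => hf y) x)

variable [T2Space E] [LocallyCompactSpace E] [MeasurableSpace E] [BorelSpace E]

/-- The sub-Markov kernel `P_t(x, ·)`: the measure representing `f ↦ (P̂_t f)(x)`
by the Riesz representation theorem. -/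
def kernel (t : ℝ≥0) (x : E) : Measure E := RealRMK.rieszMeasure (S.functional t x)

/-- `cyl t C k i x` is the iterated integral
`∫_{C (i+1)} P_{t (i+1) - t i}(x, dx_{i+1}) ⋯ ∫_{C (i+k)} P_{t (i+k) - t (i+k-1)}(x_{i+k-1}, dx_{i+k})`. -/
def cyl (t : ℕ → ℝ≥0) (C : ℕ → Set E) : ℕ → ℕ → E → ℝ≥0∞
  | 0, _, _ => 1
  | k + 1, i, x => ∫⁻ y in C (i + 1), cyl t C k (i + 1) y ∂(S.kernel (t (i + 1) - t i) x)

end FDSemigroup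

/-! ### Trajectories and diffusions -/

/-- The space `Ω` of trajectories of a diffusion: the continuous maps `[0, ∞) → E`, with the
compact-open topology (uniform convergence on compact time intervals). -/
abbrev Trajectory (E : Type*) [TopologicalSpace E] : Type _ := C(ℝ≥0, E)

/-- The σ-algebra on trajectories generated by the evaluations `X_t(ω) = ω(t)`. -/
instance Trajectory.measurableSpace (E : Type*) [TopologicalSpace E] [MeasurableSpace E] :
    MeasurableSpace (Trajectory E) :=
  ⨆ t : ℝ≥0, MeasurableSpace.comap (fun ω : Trajectory E => ω t) inferInstance

/-- A diffusion: an honest Feller-Dynkin process with continuous trajectories whose laws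
`law x` (that is, `ℙ^x`) depend weakly continuously on the starting point `x`. The law is the
unique one with `X_0 = x` and the finite-dimensional distributions given by the kernels. -/
structure Diffusion (E : Type*) [TopologicalSpace E] [T2Space E] [LocallyCompactSpace E]
    [MeasurableSpace E] [BorelSpace E] extends FDSemigroup E where
  honest : ∀ t x, toFDSemigroup.kernel t x Set.univ = 1
  law : E → Measure (Trajectory E)
  isProbabilityMeasure_law : ∀ x, IsProbabilityMeasure (law x)
  law_cylinder : ∀ (x : E) (n : ℕ) (t : ℕ → ℝ≥0) (C : ℕ → Set E), t 0 = 0 → Monotone t →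
    (∀ i, MeasurableSet (C i)) →
    law x {ω | ∀ i ≤ n, ω (t i) ∈ C i} =
      (C 0).indicator (fun x => toFDSemigroup.cyl t C n 0 x) x
  weakly_continuous : ∀ f : Trajectory E →ᵇ ℝ, Continuous fun x => ∫ ω, f ω ∂(law x)

/-! ### The functional on pseudometrics and its iteration -/

/-- The discounted uniform pseudometric `U_c(m)(ω, ω') = sup_{t ≥ 0} c^t m(ω(t), ω'(t))`. -/
def discUnif {E : Type*} [TopologicalSpace E] (c : ℝ) (m : E → E → ℝ)
    (ω ω' : Trajectory E) : ℝ :=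
  ⨆ t : ℝ≥0, c ^ (t : ℝ) * m (ω t) (ω' t)

namespace Diffusion

variable {E : Type*} [TopologicalSpace E] [T2Space E] [LocallyCompactSpace E]
  [MeasurableSpace E] [BorelSpace E] (D : Diffusion E)

/-- The functional `G_c(m)(x, y) = W(U_c(m))(ℙ^x, ℙ^y)`. It is meaningful for `m` a lower
semicontinuous 1-bounded pseudometric. -/
def G (c : ℝ) (m : E → E → ℝ) : E → E → ℝ :=
  fun x y => transportCost (discUnif c m) (D.law x) (D.law y)

/-- The sequence `d^c_0(x, y) = |obs x - obs y|`, `d^c_{n+1} = G_c(d^c_n)`. -/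
def dist (c : ℝ) (obs : E → ℝ) : ℕ → E → E → ℝ
  | 0 => fun x y => |obs x - obs y|
  | n + 1 => D.G c (dist c obs n)

/-- The pseudometric `d̄^c = sup_n d^c_n`. -/
def distSup (c : ℝ) (obs : E → ℝ) : E → E → ℝ :=
  fun x y => ⨆ n : ℕ, D.dist c obs n x y

end Diffusion

end

/-! Two facts about optimal transport carry the proof. First, `G c` preserves continuity
(`isContPseudometric_G`). If `m` is continuous, so is `discUnif c m`: discounting makes late times
negligible, and the compact-open topology controls the remaining compact time interval. Weak
convergence of the laws then drives the transport cost to zero (`tendsto_transportCost`), and the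
triangle inequality for the cost, obtained by gluing couplings, upgrades this to joint continuity.
Second, the cost passes to the limit along increasing sequences of continuous costs
(`transportCost_iSup_le`), because the couplings of two laws form a compact set.

Since time 0 alone contributes `m x y`, the functional is expansive (`le_G`). So the iterates
increase, and their supremum is lower semicontinuous. As `discUnif c` commutes with this supremum,
the second fact bounds `G c` of the supremum by the supremum of the shifted sequence; expansiveness
gives the other inequality.

Compactness and gluing require the trajectories to form a Polish space whose evaluation σ-algebra is
the Borel one. -/

/-! ### Polish and Borel structure of the state space and of the trajectories. -/

/-- A locally compact space is open in its metric completion, and open subsets of Polish spaces are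
Polish. -/
theorem polishSpace_of_locallyCompact_secondCountable (E : Type*) [TopologicalSpace E] [T2Space E]
    [LocallyCompactSpace E] [SecondCountableTopology E] : PolishSpace E := by
  let : MetricSpace E := TopologicalSpace.metrizableSpaceMetric E
  let e : E → UniformSpace.Completion E := (↑)
  have he : IsEmbedding e := UniformSpace.Completion.isUniformEmbedding_coe E |>.isEmbedding
  have hd : DenseRange e := UniformSpace.Completion.denseRange_coe
  have hopen : IsOpen (Set.range e) := by
    rw [isOpen_iff_mem_nhds]
    rintro _ ⟨x, rfl⟩
    obtain ⟨K, hK, hxK⟩ := exists_compact_mem_nhds x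
    rw [he.nhds_eq_comap, mem_comap] at hxK
    obtain ⟨t, ht, htK⟩ := hxK
    obtain ⟨V, hVt, hV, hxV⟩ := mem_nhds_iff.1 ht
    refine mem_of_superset (hV.mem_nhds hxV) fun y hy => ?_
    -- The range of `e` is dense, so its part in `V` is dense in `V`; that part lies in the compact,
    -- hence closed, set `e '' K`.
    have hy' : y ∈ closure (e '' K) := by
      refine closure_mono ?_ (hd.open_subset_closure_inter hV hy)
      rintro _ ⟨hz, z, rfl⟩
      exact ⟨z, htK (hVt hz), rfl⟩
    rw [(hK.image he.continuous).isClosed.closure_eq] at hy'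
    exact Set.image_subset_range _ _ hy'
  have : TopologicalSpace.SeparableSpace (UniformSpace.Completion E) := hd.separableSpace he.continuous
  have := hopen.polishSpace
  exact he.toHomeomorph.isClosedEmbedding.polishSpace

namespace Trajectory

theorem polishSpace (E : Type*) [TopologicalSpace E] [PolishSpace E] :
    PolishSpace (Trajectory E) := by
  let := TopologicalSpace.upgradeIsCompletelyMetrizable E
  have : TopologicalSpace.IsCompletelyMetrizableSpace (Trajectory E) := inferInstance
  infer_instance

theorem measurable_eval {E : Type*} [TopologicalSpace E] [MeasurableSpace E] (t : ℝ≥0) :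
    Measurable fun ω : Trajectory E => ω t :=
  Measurable.of_comap_le (le_iSup (fun t : ℝ≥0 =>
    MeasurableSpace.comap (fun ω : Trajectory E => ω t) inferInstance) t)

/-- Subbasic compact-open sets are determined by countably many evaluations: the image of a compact
`K` stays in an open `U` exactly when its distance to the complement of `U` is bounded below, and
this can be tested on a countable dense subset of `K`. -/
theorem borelSpace (E : Type*) [TopologicalSpace E] [PolishSpace E] [MeasurableSpace E]
    [BorelSpace E] : BorelSpace (Trajectory E) := by
  let : MetricSpace E := TopologicalSpace.metrizableSpaceMetric E
  refine ⟨le_antisymm ?_ ?_⟩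
  · refine iSup_le fun t => ?_
    rw [← measurable_iff_comap_le]
    borelize (Trajectory E)
    exact (continuous_eval_const t).measurable
  · rw [borel_eq_generateFrom_of_subbasis (ContinuousMap.compactOpen_eq)]
    refine MeasurableSpace.generateFrom_le ?_
    rintro _ ⟨K, hK, U, hU, rfl⟩
    replace hU : IsOpen U := hU
    obtain ⟨s, hsK, hsc, hKs⟩ :=
      (TopologicalSpace.IsSeparable.of_separableSpace K).exists_countable_dense_subset
    have key : {f : C(ℝ≥0, E) | Set.MapsTo f K U} =
        ⋃ n : ℕ, ⋂ d ∈ s, {f : C(ℝ≥0, E) | (n : ℝ≥0∞)⁻¹ ≤ Metric.infEDist (f d) Uᶜ} := by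
      ext f
      simp only [Set.mem_ofPred_eq, Set.mem_iUnion, Set.mem_iInter]
      have hfc : Continuous fun k => Metric.infEDist (f k) Uᶜ :=
        Metric.continuous_infEDist.comp f.continuous
      constructor
      · intro hf
        rcases K.eq_empty_or_nonempty with rfl | hne
        · exact ⟨0, fun d hd => absurd (hsK hd) (Set.notMem_empty d)⟩
        obtain ⟨k, hk, hmin⟩ := hK.exists_isMinOn hne hfc.continuousOn
        have hpos : Metric.infEDist (f k) Uᶜ ≠ 0 := fun h0 =>
          ((Metric.mem_iff_infEDist_zero_of_closed (IsOpen.isClosed_compl hU)).2 h0) (hf hk)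
        obtain ⟨n, hn⟩ := ENNReal.exists_inv_nat_lt hpos
        exact ⟨n, fun d hd => hn.le.trans (hmin (hsK hd))⟩
      · rintro ⟨n, hn⟩ k hk
        have hcl : IsClosed {t : ℝ≥0 | (n : ℝ≥0∞)⁻¹ ≤ Metric.infEDist (f t) Uᶜ} :=
          isClosed_le continuous_const hfc
        have hk' : (n : ℝ≥0∞)⁻¹ ≤ Metric.infEDist (f k) Uᶜ :=
          closure_minimal (t := {t : ℝ≥0 | (n : ℝ≥0∞)⁻¹ ≤ Metric.infEDist (f t) Uᶜ}) hn hcl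
            (hKs hk)
        by_contra hkU
        have h0 := Metric.infEDist_zero_of_mem (show f k ∈ Uᶜ from hkU)
        rw [h0, nonpos_iff_eq_zero, ENNReal.inv_eq_zero] at hk'
        exact ENNReal.natCast_ne_top n hk'
    change MeasurableSet {f : C(ℝ≥0, E) | Set.MapsTo f K U}
    rw [key]
    refine MeasurableSet.iUnion fun n => MeasurableSet.biInter hsc fun d _ => ?_
    exact measurableSet_le measurable_const
      (Metric.continuous_infEDist.measurable.comp (measurable_eval d))

end Trajectory

/-! ### The discounted uniform pseudometric. -/

section discUnif

variable {E : Type*}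

theorem IsBddPseudometric.abs_sub_le {m : E → E → ℝ} (hm : IsBddPseudometric m) (x y z w : E) :
    |m x y - m z w| ≤ m x z + m y w := by
  rw [abs_sub_le_iff]
  constructor
  · linarith [hm.triangle x z y, hm.triangle z w y, hm.symm w y]
  · linarith [hm.triangle z x w, hm.triangle x y w, hm.symm z x]

variable [TopologicalSpace E] {c : ℝ} {m : E → E → ℝ}

theorem IsBddPseudometric.discUnif_term_mem (hm : IsBddPseudometric m) (hc0 : 0 < c) (hc1 : c < 1)
    (ω ω' : Trajectory E) (t : ℝ≥0) :
    c ^ (t : ℝ) * m (ω t) (ω' t) ∈ Set.Icc (0 : ℝ) 1 :=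
  ⟨mul_nonneg (Real.rpow_nonneg hc0.le _) (hm.nonneg _ _),
    mul_le_one₀ (Real.rpow_le_one hc0.le hc1.le t.2) (hm.nonneg _ _) (hm.le_one _ _)⟩

theorem IsBddPseudometric.le_discUnif (hm : IsBddPseudometric m) (hc0 : 0 < c) (hc1 : c < 1)
    (ω ω' : Trajectory E) (t : ℝ≥0) : c ^ (t : ℝ) * m (ω t) (ω' t) ≤ discUnif c m ω ω' :=
  le_ciSup (f := fun t : ℝ≥0 => c ^ (t : ℝ) * m (ω t) (ω' t))
    ⟨1, by rintro _ ⟨t, rfl⟩; exact (hm.discUnif_term_mem hc0 hc1 ω ω' t).2⟩ t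

/-- The discounted uniform pseudometric of a bounded pseudometric is a bounded pseudometric. -/
theorem IsBddPseudometric.discUnif (hm : IsBddPseudometric m) (hc0 : 0 < c) (hc1 : c < 1) :
    IsBddPseudometric (discUnif c m) where
  nonneg ω ω' := Real.iSup_nonneg fun t => (hm.discUnif_term_mem hc0 hc1 ω ω' t).1
  le_one ω ω' := ciSup_le fun t => (hm.discUnif_term_mem hc0 hc1 ω ω' t).2
  self ω := by simp [_root_.discUnif, hm.self]
  symm ω ω' := by simp only [_root_.discUnif, hm.symm]
  triangle ω ω' ω'' := by
    refine ciSup_le fun t => ?_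
    have h1 := hm.le_discUnif hc0 hc1 ω ω' t
    have h2 := hm.le_discUnif hc0 hc1 ω' ω'' t
    have h3 := mul_le_mul_of_nonneg_left (hm.triangle (ω t) (ω' t) (ω'' t))
      (Real.rpow_nonneg hc0.le (t : ℝ))
    linarith

/-- The discounted uniform pseudometric of a continuous bounded pseudometric is continuous. -/
theorem IsContPseudometric.discUnif (hm : IsContPseudometric m) (hc0 : 0 < c) (hc1 : c < 1) :
    IsContPseudometric (discUnif c m) where
  toIsBddPseudometric := hm.toIsBddPseudometric.discUnif hc0 hc1
  cont := by
    have hb := hm.toIsBddPseudometric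
    have hpow : Continuous fun t : ℝ≥0 => c ^ (t : ℝ) :=
      (Real.continuous_const_rpow hc0.ne').comp NNReal.continuous_coe
    have hF2 : Continuous fun q : (Trajectory E × Trajectory E) × ℝ≥0 =>
        c ^ (q.2 : ℝ) * m (q.1.1 q.2) (q.1.2 q.2) :=
      (hpow.comp continuous_snd).mul (hm.cont.comp
        (((continuous_fst.comp continuous_fst).eval continuous_snd).prodMk
          ((continuous_snd.comp continuous_fst).eval continuous_snd)))
    let F : Trajectory E × Trajectory E → C(ℝ≥0, ℝ) := fun p =>
      ⟨fun t => c ^ (t : ℝ) * m (p.1 t) (p.2 t), hF2.comp (Continuous.prodMk_right p)⟩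
    have hF : Continuous F := ContinuousMap.continuous_of_continuous_uncurry F hF2
    rw [continuous_iff_lower_upperSemicontinuous]
    constructor
    · refine lowerSemicontinuous_ciSup (fun p => ⟨1, ?_⟩) fun t =>
        (hF2.comp (Continuous.prodMk_left t)).lowerSemicontinuous
      rintro _ ⟨t, rfl⟩
      exact (hb.discUnif_term_mem hc0 hc1 p.1 p.2 t).2
    -- Upper semicontinuity: choose `T` with `c ^ T < b`, so times beyond `T` contribute less than
    -- `b` for every pair; on `[0, T]` the bound by `b` is an open condition in the compact-open
    -- topology.
    · intro p a ha
      obtain ⟨b, hb1, hb2⟩ := exists_between ha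
      have hb0 : 0 < b := ((hb.discUnif hc0 hc1).nonneg _ _).trans_lt hb1
      obtain ⟨T, hT⟩ := exists_pow_lt_of_lt_one hb0 hc1
      have hopen : IsOpen {p | Set.MapsTo (F p) (Set.Icc 0 (T : ℝ≥0)) (Set.Iio b)} :=
        (ContinuousMap.isOpen_setOfPred_mapsTo isCompact_Icc isOpen_Iio).preimage hF
      filter_upwards [hopen.mem_nhds (x := p) fun t _ =>
        (hb.le_discUnif hc0 hc1 p.1 p.2 t).trans_lt hb1] with q hq
      refine lt_of_le_of_lt (ciSup_le fun t => ?_) hb2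
      rcases le_total t T with h | h
      · exact (hq ⟨zero_le, h⟩).le
      · refine le_trans ?_ hT.le
        rw [← Real.rpow_natCast]
        refine (mul_le_of_le_one_right (Real.rpow_nonneg hc0.le _) (hb.le_one _ _)).trans ?_
        exact Real.rpow_le_rpow_of_exponent_ge hc0 hc1.le (by exact_mod_cast h)

end discUnif

/-! ### Couplings and transport cost. -/

section Transport

variable {X : Type*} [MeasurableSpace X] {P Q R : Measure X} {k : X → X → ℝ}

theorem isProbabilityMeasure_of_mem_couplings [IsProbabilityMeasure P] {γ : Measure (X × X)}
    (hγ : γ ∈ couplings P Q) : IsProbabilityMeasure γ := by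
  refine ⟨?_⟩
  have h : γ.map Prod.fst Set.univ = 1 := by rw [hγ.1]; exact measure_univ
  rwa [Measure.map_apply measurable_fst MeasurableSet.univ, Set.preimage_univ] at h

theorem prod_mem_couplings [IsProbabilityMeasure P] [IsProbabilityMeasure Q] :
    P.prod Q ∈ couplings P Q := by
  constructor <;> simp

theorem transportCost_le (hk : ∀ x y, 0 ≤ k x y) {γ : Measure (X × X)} (hγ : γ ∈ couplings P Q) :
    transportCost k P Q ≤ ∫ p, k p.1 p.2 ∂γ :=
  csInf_le ⟨0, by rintro _ ⟨γ, _, rfl⟩; exact integral_nonneg fun p => hk _ _⟩ ⟨γ, hγ, rfl⟩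

/-- The product coupling makes the set of costs nonempty; otherwise `sInf` would take its default
value 0. -/
theorem le_transportCost [IsProbabilityMeasure P] [IsProbabilityMeasure Q] {r : ℝ}
    (h : ∀ γ ∈ couplings P Q, r ≤ ∫ p, k p.1 p.2 ∂γ) : r ≤ transportCost k P Q :=
  le_csInf ⟨_, P.prod Q, prod_mem_couplings, rfl⟩ (by rintro _ ⟨γ, hγ, rfl⟩; exact h γ hγ)

theorem exists_coupling_lt [IsProbabilityMeasure P] [IsProbabilityMeasure Q] {r : ℝ}
    (h : transportCost k P Q < r) : ∃ γ ∈ couplings P Q, ∫ p, k p.1 p.2 ∂γ < r := by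
  by_contra! hcon
  exact absurd (le_transportCost hcon) (not_le.2 h)

namespace IsBddPseudometric

theorem integrable_comp (hk : IsBddPseudometric k)
    (hkm : Measurable fun p : X × X => k p.1 p.2)
    {Y : Type*} [MeasurableSpace Y] {γ : Measure Y} [IsFiniteMeasure γ]
    {f g : Y → X} (hf : Measurable f) (hg : Measurable g) :
    Integrable (fun y => k (f y) (g y)) γ :=
  Integrable.of_bound (hkm.comp (hf.prodMk hg)).aestronglyMeasurable 1
    (ae_of_all _ fun y => by
      rw [Real.norm_of_nonneg (hk.nonneg _ _)]; exact hk.le_one _ _)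

theorem transportCost_nonneg (hk : IsBddPseudometric k) [IsProbabilityMeasure P] [IsProbabilityMeasure Q] :
    0 ≤ transportCost k P Q :=
  le_transportCost fun _ _ => integral_nonneg fun _ => hk.nonneg _ _

theorem transportCost_le_one (hk : IsBddPseudometric k) (hkm : Measurable fun p : X × X => k p.1 p.2)
    [IsProbabilityMeasure P] [IsProbabilityMeasure Q] :
    transportCost k P Q ≤ 1 := by
  refine (transportCost_le hk.nonneg prod_mem_couplings).trans ?_
  refine (integral_mono (hk.integrable_comp hkm measurable_fst measurable_snd)
    (integrable_const (1 : ℝ)) fun p => hk.le_one _ _).trans ?_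
  simp

theorem transportCost_self (hk : IsBddPseudometric k) (hkm : Measurable fun p : X × X => k p.1 p.2)
    [IsProbabilityMeasure P] : transportCost k P P = 0 := by
  refine le_antisymm ?_ hk.transportCost_nonneg
  have hd : Measurable fun x : X => (x, x) := measurable_id.prodMk measurable_id
  refine (transportCost_le (γ := P.map fun x => (x, x)) hk.nonneg ⟨?_, ?_⟩).trans ?_
  · rw [Measure.map_map measurable_fst hd]; exact Measure.map_id
  · rw [Measure.map_map measurable_snd hd]; exact Measure.map_id
  · rw [integral_map hd.aemeasurable hkm.aestronglyMeasurable]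
    simp [hk.self]

theorem transportCost_comm (hk : IsBddPseudometric k) (hkm : Measurable fun p : X × X => k p.1 p.2)
    [IsProbabilityMeasure P] [IsProbabilityMeasure Q] :
    transportCost k P Q = transportCost k Q P := by
  have key : ∀ (P Q : Measure X) [IsProbabilityMeasure P] [IsProbabilityMeasure Q],
      transportCost k P Q ≤ transportCost k Q P := by
    intro P Q _ _
    refine le_transportCost fun γ hγ => ?_
    refine (transportCost_le (γ := γ.map Prod.swap) hk.nonneg ⟨?_, ?_⟩).trans ?_
    · rw [Measure.map_map measurable_fst measurable_swap]; exact hγ.2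
    · rw [Measure.map_map measurable_snd measurable_swap]; exact hγ.1
    · rw [integral_map measurable_swap.aemeasurable hkm.aestronglyMeasurable]
      simp [hk.symm]
  exact le_antisymm (key P Q) (key Q P)

end IsBddPseudometric

/-- The gluing lemma: two couplings with a common marginal are marginals of one measure. -/
theorem exists_gluing [StandardBorelSpace X] [IsProbabilityMeasure P] [IsProbabilityMeasure Q]
    {γ γ' : Measure (X × X)} (hγ : γ ∈ couplings P Q) (hγ' : γ' ∈ couplings Q R) :
    ∃ Γ : Measure ((X × X) × X), IsProbabilityMeasure Γ ∧ Γ.map Prod.fst = γ ∧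
      Γ.map (fun p => (p.1.2, p.2)) = γ' := by
  have := isProbabilityMeasure_of_mem_couplings hγ
  have := isProbabilityMeasure_of_mem_couplings hγ'
  have : Nonempty X := Measure.nonempty_of_neZero Q
  -- The third coordinate is drawn from the conditional law of `γ'` given the second coordinate,
  -- ignoring the first.
  let K : ProbabilityTheory.Kernel (X × X) X := γ'.condKernel.comap (Prod.snd : X × X → X) measurable_snd
  refine ⟨γ.compProd K, inferInstance, Measure.fst_compProd γ K, ?_⟩
  have hm : Measurable fun p : (X × X) × X => (p.1.2, p.2) := by fun_prop
  have hfst : γ'.fst = γ.map Prod.snd := hγ'.1.trans hγ.2.symm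
  conv_rhs => rw [← γ'.disintegrate γ'.condKernel, hfst]
  have : SFinite (γ.map Prod.snd) := by rw [hγ.2]; infer_instance
  ext s hs
  rw [Measure.map_apply hm hs, Measure.compProd_apply (hm hs), Measure.compProd_apply hs,
    lintegral_map (ProbabilityTheory.Kernel.measurable_kernel_prodMk_left hs) measurable_snd]
  rfl

theorem IsBddPseudometric.transportCost_triangle [StandardBorelSpace X] (hk : IsBddPseudometric k)
    (hkm : Measurable fun p : X × X => k p.1 p.2)
    [IsProbabilityMeasure P] [IsProbabilityMeasure Q] [IsProbabilityMeasure R] :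
    transportCost k P R ≤ transportCost k P Q + transportCost k Q R := by
  refine le_of_forall_pos_le_add fun ε hε => ?_
  obtain ⟨γ, hγ, h1⟩ := exists_coupling_lt (show transportCost k P Q < transportCost k P Q + ε / 2
    by linarith)
  obtain ⟨γ', hγ', h2⟩ := exists_coupling_lt (show transportCost k Q R < transportCost k Q R + ε / 2
    by linarith)
  obtain ⟨Γ, _, hΓ, hΓ'⟩ := exists_gluing hγ hγ'
  have hm : Measurable fun p : (X × X) × X => (p.1.2, p.2) := by fun_prop
  have hm' : Measurable fun p : (X × X) × X => (p.1.1, p.2) := by fun_prop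
  have hmem : Γ.map (fun p => (p.1.1, p.2)) ∈ couplings P R := by
    constructor
    · rw [Measure.map_map measurable_fst hm', ← hγ.1, ← hΓ,
        Measure.map_map measurable_fst measurable_fst]
      rfl
    · rw [Measure.map_map measurable_snd hm', ← hγ'.2, ← hΓ', Measure.map_map measurable_snd hm]
      rfl
  have h3 := transportCost_le hk.nonneg hmem
  rw [integral_map hm'.aemeasurable hkm.aestronglyMeasurable] at h3
  rw [← hΓ, integral_map measurable_fst.aemeasurable hkm.aestronglyMeasurable] at h1
  rw [← hΓ', integral_map hm.aemeasurable hkm.aestronglyMeasurable] at h2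
  have i1 : Integrable (fun p : (X × X) × X => k p.1.1 p.1.2) Γ :=
    hk.integrable_comp hkm (by fun_prop) (by fun_prop)
  have i2 : Integrable (fun p : (X × X) × X => k p.1.2 p.2) Γ :=
    hk.integrable_comp hkm (by fun_prop) (by fun_prop)
  have h4 : ∫ p, k p.1.1 p.2 ∂Γ ≤ ∫ p, k p.1.1 p.1.2 ∂Γ + ∫ p, k p.1.2 p.2 ∂Γ := by
    rw [← integral_add i1 i2]
    exact integral_mono (hk.integrable_comp hkm (by fun_prop) (by fun_prop)) (i1.add i2)
      fun p => hk.triangle _ _ _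
  linarith

/-- A measure whose marginals are dominated by two probability measures extends to a coupling
of these, at a cost of at most the missing mass. -/
theorem IsBddPseudometric.transportCost_le_of_marginals_le (hk : IsBddPseudometric k)
    (hkm : Measurable fun p : X × X => k p.1 p.2)
    [IsProbabilityMeasure P] [IsProbabilityMeasure Q] {γ : Measure (X × X)}
    (h1 : γ.map Prod.fst ≤ P) (h2 : γ.map Prod.snd ≤ Q) :
    transportCost k P Q ≤ ∫ p, k p.1 p.2 ∂γ + (1 - γ.real Set.univ) := by
  have hu1 : γ.map Prod.fst Set.univ = γ Set.univ := by
    rw [Measure.map_apply measurable_fst MeasurableSet.univ, Set.preimage_univ]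
  have hu2 : γ.map Prod.snd Set.univ = γ Set.univ := by
    rw [Measure.map_apply measurable_snd MeasurableSet.univ, Set.preimage_univ]
  have hle : γ Set.univ ≤ 1 := by
    rw [← hu1, ← measure_univ (μ := P)]; exact h1 _
  have : IsFiniteMeasure γ := ⟨hle.trans_lt ENNReal.one_lt_top⟩
  set P' := P - γ.map Prod.fst with hP'
  set Q' := Q - γ.map Prod.snd with hQ'
  set r := 1 - γ Set.univ with hr
  have hPr : P' Set.univ = r := by
    rw [hP', Measure.sub_apply MeasurableSet.univ h1, measure_univ, hu1]
  have hQr : Q' Set.univ = r := by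
    rw [hQ', Measure.sub_apply MeasurableSet.univ h2, measure_univ, hu2]
  have hrtop : r ≠ ∞ := ne_top_of_le_ne_top ENNReal.one_ne_top tsub_le_self
  -- When `r = 0` the factor `r⁻¹ * r` is 0 rather than 1, but then `M` itself vanishes.
  have hscale : ∀ M : Measure X, M Set.univ = r → (r⁻¹ * r) • M = M := by
    intro M hM
    rcases eq_or_ne r 0 with h0 | h0
    · rw [h0, Measure.measure_univ_eq_zero] at hM
      simp [hM]
    · rw [ENNReal.inv_mul_cancel h0 hrtop, one_smul]
  have hmass : (r⁻¹ • P'.prod Q') Set.univ = r := by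
    rw [Measure.smul_apply, ← Set.univ_prod_univ, Measure.prod_prod, hPr, hQr, smul_eq_mul,
      ← mul_assoc, ← smul_eq_mul (r⁻¹ * r), ← hPr, ← Measure.smul_apply, hPr, hscale P' hPr, hPr]
  have : IsFiniteMeasure (r⁻¹ • P'.prod Q') := ⟨by rw [hmass]; exact hrtop.lt_top⟩
  -- The two marginal deficits have the same mass `r`, so their normalized product supplies exactly
  -- the missing marginals.
  have hmem : γ + r⁻¹ • P'.prod Q' ∈ couplings P Q := by
    constructor
    · rw [Measure.map_add _ _ measurable_fst, Measure.map_smul, Measure.map_fst_prod, hQr,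
        smul_smul, hscale P' hPr, add_comm, hP', Measure.sub_add_cancel_of_le h1]
    · rw [Measure.map_add _ _ measurable_snd, Measure.map_smul, Measure.map_snd_prod, hPr,
        smul_smul, hscale Q' hQr, add_comm, hQ', Measure.sub_add_cancel_of_le h2]
  refine (transportCost_le hk.nonneg hmem).trans ?_
  rw [integral_add_measure (hk.integrable_comp hkm measurable_fst measurable_snd)
    (hk.integrable_comp hkm measurable_fst measurable_snd)]
  gcongr
  refine (integral_mono (hk.integrable_comp hkm measurable_fst measurable_snd)
    (integrable_const (1 : ℝ)) fun p => hk.le_one _ _).trans ?_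
  rw [integral_const, smul_eq_mul, mul_one, measureReal_def, hmass, hr,
    ENNReal.toReal_sub_of_le hle ENNReal.one_ne_top, ENNReal.toReal_one, measureReal_def]

/-- The scaled product measure `s • (f P) ⊗ (f Q)` with `s` chosen such that its marginals are
dominated by `f P` and `f Q` and its mass is the smaller of the two masses. -/
noncomputable def commonPart (P Q : Measure X) (f : X → ℝ≥0∞) : Measure (X × X) :=
  (min (∫⁻ x, f x ∂P) (∫⁻ x, f x ∂Q) / ((∫⁻ x, f x ∂P) * ∫⁻ x, f x ∂Q)) •
    (P.withDensity f).prod (Q.withDensity f)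

/-- Each marginal of `commonPart` is a density measure scaled by such a factor; this keeps the
marginals dominated. -/
theorem min_div_mul_le_one (a b : ℝ≥0∞) : min a b / (a * b) * b ≤ 1 := by
  rcases eq_or_ne a 0 with rfl | ha
  · simp
  rcases eq_or_ne b 0 with rfl | hb
  · simp
  rcases eq_or_ne a ∞ with rfl | ha'
  · simp [ENNReal.top_mul hb]
  rcases eq_or_ne b ∞ with rfl | hb'
  · simp [ENNReal.mul_top ha]
  rw [ENNReal.div_eq_inv_mul, ENNReal.mul_inv (Or.inl ha) (Or.inl ha')]
  calc a⁻¹ * b⁻¹ * min a b * b = (a⁻¹ * min a b) * (b⁻¹ * b) := by ring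
    _ ≤ (a⁻¹ * a) * (b⁻¹ * b) := by gcongr; exact min_le_left _ _
    _ = 1 := by rw [ENNReal.inv_mul_cancel ha ha', ENNReal.inv_mul_cancel hb hb', one_mul]

theorem min_div_mul_mul {a b : ℝ≥0∞} (ha' : a ≠ ∞) (hb' : b ≠ ∞) :
    min a b / (a * b) * (a * b) = min a b := by
  rcases eq_or_ne a 0 with rfl | ha
  · simp
  rcases eq_or_ne b 0 with rfl | hb
  · simp
  exact ENNReal.div_mul_cancel (mul_ne_zero ha hb) (ENNReal.mul_ne_top ha' hb')

theorem lintegral_ne_top_of_le_one [IsProbabilityMeasure P] {f : X → ℝ≥0∞} (hf : ∀ x, f x ≤ 1) :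
    ∫⁻ x, f x ∂P ≠ ∞ := by
  refine ne_top_of_le_ne_top ENNReal.one_ne_top ((lintegral_mono hf).trans ?_)
  simp

theorem isFiniteMeasure_withDensity_of_le_one [IsProbabilityMeasure P] {f : X → ℝ≥0∞}
    (hf : ∀ x, f x ≤ 1) : IsFiniteMeasure (P.withDensity f) :=
  isFiniteMeasure_withDensity (lintegral_ne_top_of_le_one hf)

theorem map_fst_commonPart_le [IsProbabilityMeasure P] [IsProbabilityMeasure Q] {f : X → ℝ≥0∞}
    (hf : ∀ x, f x ≤ 1) : (commonPart P Q f).map Prod.fst ≤ P.withDensity f := by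
  have := isFiniteMeasure_withDensity_of_le_one (P := P) hf
  have := isFiniteMeasure_withDensity_of_le_one (P := Q) hf
  rw [commonPart, Measure.map_smul, Measure.map_fst_prod, smul_smul, withDensity_apply _ .univ,
    Measure.restrict_univ]
  intro s
  rw [Measure.smul_apply, smul_eq_mul]
  exact mul_le_of_le_one_left zero_le (min_div_mul_le_one _ _)

theorem map_snd_commonPart_le [IsProbabilityMeasure P] [IsProbabilityMeasure Q] {f : X → ℝ≥0∞}
    (hf : ∀ x, f x ≤ 1) : (commonPart P Q f).map Prod.snd ≤ Q.withDensity f := by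
  have := isFiniteMeasure_withDensity_of_le_one (P := P) hf
  have := isFiniteMeasure_withDensity_of_le_one (P := Q) hf
  rw [commonPart, Measure.map_smul, Measure.map_snd_prod, smul_smul, withDensity_apply _ .univ,
    Measure.restrict_univ, min_comm, mul_comm (∫⁻ x, f x ∂P) (∫⁻ x, f x ∂Q)]
  intro s
  rw [Measure.smul_apply, smul_eq_mul]
  exact mul_le_of_le_one_left zero_le (min_div_mul_le_one _ _)

theorem commonPart_univ [IsProbabilityMeasure P] [IsProbabilityMeasure Q] {f : X → ℝ≥0∞}
    (hf : ∀ x, f x ≤ 1) :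
    commonPart P Q f Set.univ = min (∫⁻ x, f x ∂P) (∫⁻ x, f x ∂Q) := by
  have := isFiniteMeasure_withDensity_of_le_one (P := P) hf
  have := isFiniteMeasure_withDensity_of_le_one (P := Q) hf
  rw [commonPart, Measure.smul_apply, ← Set.univ_prod_univ, Measure.prod_prod,
    withDensity_apply _ .univ, withDensity_apply _ .univ, Measure.restrict_univ,
    Measure.restrict_univ, smul_eq_mul,
    min_div_mul_mul (lintegral_ne_top_of_le_one hf) (lintegral_ne_top_of_le_one hf)]

theorem ae_commonPart [IsProbabilityMeasure P] [IsProbabilityMeasure Q] {f : X → ℝ≥0∞}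
    (hf : ∀ x, f x ≤ 1) (hfm : Measurable f) :
    ∀ᵐ p ∂commonPart P Q f, f p.1 ≠ 0 ∧ f p.2 ≠ 0 := by
  have := isFiniteMeasure_withDensity_of_le_one (P := P) hf
  have := isFiniteMeasure_withDensity_of_le_one (P := Q) hf
  refine Measure.ae_smul_measure ?_ _
  have h : ∀ (M : Measure X), ∀ᵐ x ∂M.withDensity f, f x ≠ 0 := fun M => by
    rw [ae_withDensity_iff hfm]
    exact ae_of_all _ fun x hx => hx
  exact (Measure.quasiMeasurePreserving_fst.ae (h P)).and
    (Measure.quasiMeasurePreserving_snd.ae (h Q))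

/-- An upper bound for the transport cost by means of a finite partial partition into functions
of small support. -/
theorem IsBddPseudometric.transportCost_le_of_partition (hk : IsBddPseudometric k)
    (hkm : Measurable fun p : X × X => k p.1 p.2)
    [IsProbabilityMeasure P] [IsProbabilityMeasure Q] (N : ℕ) {f : ℕ → X → ℝ}
    (hf0 : ∀ i x, 0 ≤ f i x) (hfm : ∀ i, Measurable (f i))
    (hfsum : ∀ x, ∑ i ∈ Finset.range N, f i x ≤ 1) (hf1 : ∀ i x, f i x ≤ 1)
    (a : ℕ → X) {δ : ℝ} (hδ : 0 ≤ δ) (hfa : ∀ i x, f i x ≠ 0 → k x (a i) ≤ δ) :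
    transportCost k P Q ≤
      2 * δ + (1 - ∑ i ∈ Finset.range N, min (∫ x, f i x ∂P) (∫ x, f i x ∂Q)) := by
  set g : ℕ → X → ℝ≥0∞ := fun i x => ENNReal.ofReal (f i x) with hg
  have hg1 : ∀ i x, g i x ≤ 1 := fun i x => by simpa [hg] using hf1 i x
  have hgm : ∀ i, Measurable (g i) := fun i => (hfm i).ennreal_ofReal
  set γ : Measure (X × X) := ∑ i ∈ Finset.range N, commonPart P Q (g i) with hγ
  have hsum : ∀ M : Measure X, ∑ i ∈ Finset.range N, M.withDensity (g i) ≤ M := by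
    intro M
    refine Measure.le_iff.2 fun s hs => ?_
    rw [Measure.finsetSum_apply]
    simp_rw [withDensity_apply _ hs]
    rw [← lintegral_finsetSum _ fun i _ => hgm i, ← setLIntegral_one]
    refine lintegral_mono fun x => ?_
    rw [← ENNReal.ofReal_sum_of_nonneg fun i _ => hf0 i x]
    simpa using hfsum x
  have hmap : ∀ {φ : X × X → X}, Measurable φ → γ.map φ =
      ∑ i ∈ Finset.range N, (commonPart P Q (g i)).map φ := fun {φ} hφ => by
    ext s hs
    rw [Measure.map_apply hφ hs, hγ, Measure.finsetSum_apply, Measure.finsetSum_apply]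
    simp_rw [Measure.map_apply hφ hs]
  have h1 : γ.map Prod.fst ≤ P := by
    rw [hmap measurable_fst]
    exact (Finset.sum_le_sum fun i _ => map_fst_commonPart_le (hg1 i)).trans (hsum P)
  have h2 : γ.map Prod.snd ≤ Q := by
    rw [hmap measurable_snd]
    exact (Finset.sum_le_sum fun i _ => map_snd_commonPart_le (hg1 i)).trans (hsum Q)
  have hint : ∀ (M : Measure X) [IsProbabilityMeasure M] i,
      (∫⁻ x, g i x ∂M) = ENNReal.ofReal (∫ x, f i x ∂M) := fun M _ i => by
    rw [ofReal_integral_eq_lintegral_ofReal _ (ae_of_all _ (hf0 i))]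
    exact Integrable.of_bound (hfm i).aestronglyMeasurable 1 (ae_of_all _ fun x => by
      rw [Real.norm_of_nonneg (hf0 i x)]; exact hf1 i x)
  have hint0 : ∀ (M : Measure X) i, 0 ≤ ∫ x, f i x ∂M := fun M i => integral_nonneg (hf0 i)
  have huniv : γ Set.univ =
      ENNReal.ofReal (∑ i ∈ Finset.range N, min (∫ x, f i x ∂P) (∫ x, f i x ∂Q)) := by
    rw [hγ, Measure.finsetSum_apply,
      ENNReal.ofReal_sum_of_nonneg fun i _ => le_min (hint0 P i) (hint0 Q i)]
    refine Finset.sum_congr rfl fun i _ => ?_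
    rw [commonPart_univ (hg1 i), hint, hint, ENNReal.ofReal_min]
  have hreal : γ.real Set.univ =
      ∑ i ∈ Finset.range N, min (∫ x, f i x ∂P) (∫ x, f i x ∂Q) := by
    rw [measureReal_def, huniv, ENNReal.toReal_ofReal]
    exact Finset.sum_nonneg fun i _ => le_min (hint0 P i) (hint0 Q i)
  have : IsFiniteMeasure γ := ⟨by rw [huniv]; exact ENNReal.ofReal_lt_top⟩
  have hle1 : γ.real Set.univ ≤ 1 := by
    rw [hreal]
    refine (Finset.sum_le_sum fun i _ => min_le_left _ _).trans ?_
    rw [← integral_finsetSum _ fun i _ => Integrable.of_bound (hfm i).aestronglyMeasurable 1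
      (ae_of_all _ fun x => by rw [Real.norm_of_nonneg (hf0 i x)]; exact hf1 i x)]
    refine (integral_mono_of_nonneg (ae_of_all _ fun x => Finset.sum_nonneg fun i _ => hf0 i x)
      (integrable_const (1 : ℝ)) (ae_of_all _ hfsum)).trans ?_
    simp
  -- Each common part lives where both coordinates are in the support of the same `f i`, hence both
  -- within `δ` of `a i`.
  have hae : ∀ᵐ p ∂γ, k p.1 p.2 ≤ 2 * δ := by
    rw [ae_iff, hγ, Measure.finsetSum_apply]
    refine Finset.sum_eq_zero fun i _ => ?_
    rw [← ae_iff]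
    filter_upwards [ae_commonPart (P := P) (Q := Q) (hg1 i) (hgm i)] with p hp
    have e1 := hfa i p.1 fun h => hp.1 (by simp [hg, h])
    have e2 := hfa i p.2 fun h => hp.2 (by simp [hg, h])
    linarith [hk.triangle p.1 (a i) p.2, hk.symm (a i) p.2]
  refine (hk.transportCost_le_of_marginals_le hkm h1 h2).trans ?_
  rw [← hreal]
  gcongr
  refine (integral_mono_ae (hk.integrable_comp hkm measurable_fst measurable_snd)
    (integrable_const (2 * δ)) hae).trans ?_
  rw [integral_const, smul_eq_mul]
  exact mul_le_of_le_one_left (by linarith) hle1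

/-! ### Transport cost, weak convergence and compactness. -/

variable [TopologicalSpace X]

/-- Weak convergence of probability measures implies convergence of the transport cost to zero,
for a continuous bounded pseudometric. The proof uses the continuous functions
`h i * ∏ j < i, (1 - h j)`, where `h j` is a bump function on the `k`-ball of radius `2 * δ` around
the `j`-th point of a dense sequence. -/
theorem IsContPseudometric.tendsto_transportCost [SecondCountableTopology X]
    [OpensMeasurableSpace X] (hk : IsContPseudometric k) {ι : Type*} {l : Filter ι}
    {M : ι → Measure X} [∀ i, IsProbabilityMeasure (M i)] [IsProbabilityMeasure P]
    (hM : ∀ f : X →ᵇ ℝ, Tendsto (fun i => ∫ x, f x ∂(M i)) l (𝓝 (∫ x, f x ∂P))) :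
    Tendsto (fun i => transportCost k (M i) P) l (𝓝 0) := by
  have hb := hk.toIsBddPseudometric
  have hkm : Measurable fun p : X × X => k p.1 p.2 := hk.cont.measurable
  have : Nonempty X := Measure.nonempty_of_neZero P
  have hkx : ∀ y, Continuous fun x => k x y := fun y => hk.cont.comp (Continuous.prodMk_left y)
  set a := TopologicalSpace.denseSeq X
  rw [Metric.tendsto_nhds]
  intro ε hε
  -- The bumps live within `2 * δ` of their centres, so the partition bound costs `4 * δ = ε / 2`;
  -- the missing mass will add less than `ε / 4`.
  set δ := ε / 8 with hδ
  have hδ0 : 0 < δ := by positivity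
  let h : ℕ → X → ℝ := fun j x => min 1 (max 0 (2 - k x (a j) / δ))
  have hh0 : ∀ j x, 0 ≤ h j x := fun j x => le_min zero_le_one (le_max_left _ _)
  have hh1 : ∀ j x, h j x ≤ 1 := fun j x => min_le_left _ _
  have hhc : ∀ j, Continuous (h j) := fun j =>
    continuous_const.min (continuous_const.max (continuous_const.sub ((hkx _).div_const _)))
  let p : ℕ → X → ℝ := fun n x => ∏ j ∈ Finset.range n, (1 - h j x)
  have hp0 : ∀ n x, 0 ≤ p n x := fun n x =>
    Finset.prod_nonneg fun j _ => sub_nonneg.2 (hh1 j x)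
  have hp1 : ∀ n x, p n x ≤ 1 := fun n x =>
    Finset.prod_le_one (fun j _ => sub_nonneg.2 (hh1 j x)) fun j _ => by linarith [hh0 j x]
  have hpc : ∀ n, Continuous (p n) := fun n =>
    continuous_finsetProd _ fun j _ => continuous_const.sub (hhc j)
  have hplim : ∀ x, Tendsto (fun n => p n x) atTop (𝓝 0) := by
    intro x
    obtain ⟨j, hj⟩ : ∃ j, k x (a j) < δ := by
      have hopen : IsOpen {y | k x y < δ} :=
        isOpen_lt (hk.cont.comp (Continuous.prodMk_right x)) continuous_const
      obtain ⟨_, hy, j, rfl⟩ := (TopologicalSpace.denseRange_denseSeq X).inter_open_nonempty _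
        hopen ⟨x, by simpa [hb.self] using hδ0⟩
      exact ⟨j, hy⟩
    have hhj : h j x = 1 := by
      refine min_eq_left (le_max_of_le_right ?_)
      have : k x (a j) / δ < 1 := (div_lt_one hδ0).2 hj
      linarith
    refine tendsto_const_nhds.congr' ?_
    filter_upwards [eventually_gt_atTop j] with n hn
    exact (Finset.prod_eq_zero (Finset.mem_range.2 hn) (by rw [hhj, sub_self])).symm
  have hpint : Tendsto (fun n => ∫ x, p n x ∂P) atTop (𝓝 0) := by
    have := tendsto_integral_of_dominated_convergence (μ := P) (F := p) (f := fun _ => 0)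
      (fun _ => 1) (fun n => (hpc n).measurable.aestronglyMeasurable) (integrable_const _)
      (fun n => ae_of_all _ fun x => by rw [Real.norm_of_nonneg (hp0 n x)]; exact hp1 n x)
      (ae_of_all _ hplim)
    simpa using this
  obtain ⟨N, hN⟩ := (hpint.eventually_lt_const (show (0 : ℝ) < ε / 4 by linarith)).exists
  -- Written as differences, these functions telescope: the first `N` sum to `1 - p N`, and `N` was
  -- chosen to make the integral of `p N` small.
  let f : ℕ → X → ℝ := fun i x => p i x - p (i + 1) x
  have hfeq : ∀ i x, f i x = p i x * h i x := fun i x => by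
    simp only [f, p, Finset.prod_range_succ]; ring
  have hf0 : ∀ i x, 0 ≤ f i x := fun i x => by
    rw [hfeq]; exact mul_nonneg (hp0 i x) (hh0 i x)
  have hf1 : ∀ i x, f i x ≤ 1 := fun i x => by
    rw [hfeq]; exact mul_le_one₀ (hp1 i x) (hh0 i x) (hh1 i x)
  have hfc : ∀ i, Continuous (f i) := fun i => (hpc i).sub (hpc (i + 1))
  have hfsum : ∀ x, ∑ i ∈ Finset.range N, f i x = 1 - p N x := fun x => by
    rw [Finset.sum_range_sub' (fun i => p i x) N]; simp [p]
  have hfa : ∀ i x, f i x ≠ 0 → k x (a i) ≤ 2 * δ := by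
    intro i x hfi
    by_contra! hcon
    refine hfi ?_
    rw [hfeq]
    have : 2 < k x (a i) / δ := (lt_div_iff₀ hδ0).2 hcon
    have : h i x = 0 := by
      simp only [h]
      rw [max_eq_left (by linarith), min_eq_right zero_le_one]
    rw [this, mul_zero]
  have hlim : Tendsto
      (fun n => ∑ i ∈ Finset.range N, min (∫ x, f i x ∂(M n)) (∫ x, f i x ∂P)) l
      (𝓝 (∑ i ∈ Finset.range N, min (∫ x, f i x ∂P) (∫ x, f i x ∂P))) := by
    refine tendsto_finsetSum _ fun i _ => Tendsto.min ?_ tendsto_const_nhds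
    exact hM (BoundedContinuousFunction.ofNormedAddCommGroup (f i) (hfc i) 1 fun x => by
      rw [Real.norm_of_nonneg (hf0 i x)]; exact hf1 i x)
  have hval : 1 - ε / 4 < ∑ i ∈ Finset.range N, min (∫ x, f i x ∂P) (∫ x, f i x ∂P) := by
    simp_rw [min_self]
    rw [← integral_finsetSum _ fun i _ => Integrable.of_bound
      (hfc i).measurable.aestronglyMeasurable 1 (ae_of_all _ fun x => by
        rw [Real.norm_of_nonneg (hf0 i x)]; exact hf1 i x)]
    simp_rw [hfsum]
    rw [integral_sub (integrable_const _) (Integrable.of_bound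
      (hpc N).measurable.aestronglyMeasurable 1 (ae_of_all _ fun x => by
        rw [Real.norm_of_nonneg (hp0 N x)]; exact hp1 N x))]
    simp only [integral_const, probReal_univ, smul_eq_mul, mul_one]
    linarith
  filter_upwards [hlim.eventually_const_lt hval] with n hn
  have := hb.transportCost_le_of_partition (P := M n) (Q := P) hkm N hf0
    (fun i => (hfc i).measurable) (fun x => by rw [hfsum]; linarith [hp0 N x]) hf1 a
    (δ := 2 * δ) (by linarith) hfa
  rw [Real.dist_eq, sub_zero, abs_of_nonneg hb.transportCost_nonneg]
  linarith

/-- The set of couplings of two probability measures on a Polish space is compact. -/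
theorem isCompact_couplings [PolishSpace X] [BorelSpace X] (P Q : Measure X)
    [IsProbabilityMeasure P] [IsProbabilityMeasure Q] :
    IsCompact {γ : ProbabilityMeasure (X × X) | (γ : Measure (X × X)) ∈ couplings P Q} := by
  set S := {γ : ProbabilityMeasure (X × X) | (γ : Measure (X × X)) ∈ couplings P Q}
  -- Tightness of a set of couplings follows from that of the marginals, here single measures on a
  -- Polish space; Prokhorov's theorem then applies.
  have htight : IsTightMeasureSet {((γ : ProbabilityMeasure (X × X)) : Measure (X × X)) | γ ∈ S} := by
    refine IsTightMeasureSet.prodMk ((isTightMeasureSet_singleton (μ := P)).subset ?_)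
      ((isTightMeasureSet_singleton (μ := Q)).subset ?_)
    · rintro _ ⟨_, ⟨γ, hγ, rfl⟩, rfl⟩; exact hγ.1
    · rintro _ ⟨_, ⟨γ, hγ, rfl⟩, rfl⟩; exact hγ.2
  have hclosed : IsClosed S := by
    have : S = {γ | γ.map measurable_fst.aemeasurable = ⟨P, inferInstance⟩} ∩
        {γ | γ.map measurable_snd.aemeasurable = ⟨Q, inferInstance⟩} := by
      ext γ
      simp only [S, couplings, Set.mem_ofPred_eq, Set.mem_inter_iff]
      exact and_congr (Subtype.ext_iff (a1 := γ.map measurable_fst.aemeasurable)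
          (a2 := ⟨P, inferInstance⟩)).symm
        (Subtype.ext_iff (a1 := γ.map measurable_snd.aemeasurable) (a2 := ⟨Q, inferInstance⟩)).symm
    rw [this]
    exact (isClosed_eq (ProbabilityMeasure.continuous_map continuous_fst) continuous_const).inter
      (isClosed_eq (ProbabilityMeasure.continuous_map continuous_snd) continuous_const)
  have := isCompact_closure_of_isTightMeasureSet htight
  rwa [hclosed.closure_eq] at this

/-- The transport cost commutes with suprema of increasing sequences of continuous costs. -/
theorem transportCost_iSup_le [PolishSpace X] [BorelSpace X]
    [IsProbabilityMeasure P] [IsProbabilityMeasure Q] {k : ℕ → X → X → ℝ}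
    (hk0 : ∀ n x y, 0 ≤ k n x y) (hk1 : ∀ n x y, k n x y ≤ 1)
    (hkc : ∀ n, Continuous fun p : X × X => k n p.1 p.2) (hmono : ∀ x y, Monotone fun n => k n x y)
    {r : ℝ} (hr : ∀ n, transportCost (k n) P Q ≤ r) :
    transportCost (fun x y => ⨆ n, k n x y) P Q ≤ r := by
  have hbdd : ∀ x y, BddAbove (Set.range fun n => k n x y) := fun x y =>
    ⟨1, by rintro _ ⟨n, rfl⟩; exact hk1 n x y⟩
  have hint : ∀ n (γ : Measure (X × X)) [IsProbabilityMeasure γ],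
      Integrable (fun p : X × X => k n p.1 p.2) γ := fun n γ _ =>
    Integrable.of_bound (hkc n).measurable.aestronglyMeasurable 1 (ae_of_all _ fun p => by
      rw [Real.norm_of_nonneg (hk0 n _ _)]; exact hk1 n _ _)
  have hex : ∀ n : ℕ, ∃ γ : ProbabilityMeasure (X × X), (γ : Measure (X × X)) ∈ couplings P Q ∧
      ∫ p, k n p.1 p.2 ∂(γ : Measure (X × X)) < r + 1 / ((n : ℝ) + 1) := by
    intro n
    obtain ⟨γ, hγ, h⟩ := exists_coupling_lt
      ((hr n).trans_lt (lt_add_of_pos_right r (Nat.one_div_pos_of_nat (n := n))))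
    exact ⟨⟨γ, isProbabilityMeasure_of_mem_couplings hγ⟩, hγ, h⟩
  choose γ hγ hγr using hex
  -- A limit along a nonprincipal ultrafilter replaces the extraction of a convergent subsequence of
  -- near-optimal couplings.
  obtain ⟨γ₀, hγ₀, hlim⟩ := (isCompact_couplings P Q).ultrafilter_le_nhds'
    ((hyperfilter ℕ).map γ)
    (Ultrafilter.mem_map.2 (Eventually.of_forall hγ))
  have hle : ((hyperfilter ℕ : Ultrafilter ℕ) : Filter ℕ) ≤ atTop := Nat.hyperfilter_le_atTop
  have hlim : Tendsto γ (hyperfilter ℕ) (𝓝 γ₀) := hlim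
  have hbound : ∀ m, ∫ p, k m p.1 p.2 ∂(γ₀ : Measure (X × X)) ≤ r := by
    intro m
    have h1 := ProbabilityMeasure.tendsto_iff_forall_integral_tendsto.1 hlim
      (BoundedContinuousFunction.ofNormedAddCommGroup (fun p : X × X => k m p.1 p.2) (hkc m) 1
        fun p => by rw [Real.norm_of_nonneg (hk0 m _ _)]; exact hk1 m _ _)
    have h2 : Tendsto (fun n : ℕ => r + 1 / ((n : ℝ) + 1)) (hyperfilter ℕ) (𝓝 (r + 0)) :=
      tendsto_const_nhds.add (tendsto_one_div_add_atTop_nhds_zero_nat.mono_left hle)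
    rw [add_zero] at h2
    refine le_of_tendsto_of_tendsto h1 h2 (hle ?_)
    -- For fixed `m`, monotonicity lets the near-optimal coupling for any later cost `k n` also
    -- bound the integral of `k m`.
    filter_upwards [eventually_ge_atTop m] with n hn
    exact (integral_mono (hint m _) (hint n _) fun p => hmono p.1 p.2 hn).trans (hγr n).le
  refine (transportCost_le (fun x y => Real.iSup_nonneg fun n => hk0 n x y) hγ₀).trans ?_
  refine le_of_tendsto' (tendsto_integral_of_dominated_convergence (μ := (γ₀ : Measure (X × X)))
    (F := fun n p => k n p.1 p.2) (fun _ => 1)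
    (fun n => (hkc n).measurable.aestronglyMeasurable) (integrable_const _)
    (fun n => ae_of_all _ fun p => by rw [Real.norm_of_nonneg (hk0 n _ _)]; exact hk1 n _ _)
    (ae_of_all _ fun p => tendsto_atTop_ciSup (hmono p.1 p.2) (hbdd p.1 p.2))) hbound

end Transport

/-! ### The functional of a diffusion. -/

namespace Diffusion

variable {E : Type*} [TopologicalSpace E] [T2Space E] [LocallyCompactSpace E]
  [MeasurableSpace E] [BorelSpace E] (D : Diffusion E)

/-- This is the cylinder formula with time 0 only and the singleton of the starting point. -/
theorem ae_law_eval_zero (x : E) : ∀ᵐ ω ∂(D.law x), ω 0 = x := by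
  have := D.isProbabilityMeasure_law x
  have h := D.law_cylinder x 0 (fun _ => 0) (fun _ => {x}) rfl monotone_const
    fun _ => isClosed_singleton.measurableSet
  have h1 : (D.law x) {ω | ω 0 = x} = 1 := by
    simpa [FDSemigroup.cyl] using h
  have hm : MeasurableSet {ω : Trajectory E | ω 0 = x} :=
    (Trajectory.measurable_eval 0) isClosed_singleton.measurableSet
  exact (prob_compl_eq_zero_iff hm).2 h1

variable {c : ℝ}

/-- The functional `G` is expansive, since trajectories start at their starting point. -/
theorem le_G {m : E → E → ℝ} (hm : IsBddPseudometric m)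
    (hUm : Measurable fun p : Trajectory E × Trajectory E => discUnif c m p.1 p.2)
    (hc0 : 0 < c) (hc1 : c < 1) (x y : E) : m x y ≤ D.G c m x y := by
  have := D.isProbabilityMeasure_law
  refine le_transportCost fun γ hγ => ?_
  have := isProbabilityMeasure_of_mem_couplings hγ
  have hx : ∀ᵐ p ∂γ, p.1 0 = x :=
    ae_of_ae_map measurable_fst.aemeasurable (hγ.1 ▸ D.ae_law_eval_zero x)
  have hy : ∀ᵐ p ∂γ, p.2 0 = y :=
    ae_of_ae_map measurable_snd.aemeasurable (hγ.2 ▸ D.ae_law_eval_zero y)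
  calc m x y = ∫ _, m x y ∂γ := by simp
    _ ≤ ∫ p, discUnif c m p.1 p.2 ∂γ := by
      refine integral_mono_ae (integrable_const _)
        ((hm.discUnif hc0 hc1).integrable_comp hUm measurable_fst measurable_snd) ?_
      filter_upwards [hx, hy] with p hpx hpy
      -- At time 0 the discount factor is 1.
      simpa [hpx, hpy] using hm.le_discUnif hc0 hc1 p.1 p.2 0

variable [SecondCountableTopology E]

theorem isContPseudometric_G {m : E → E → ℝ} (hm : IsContPseudometric m) (hc0 : 0 < c)
    (hc1 : c < 1) : IsContPseudometric (D.G c m) := by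
  have := polishSpace_of_locallyCompact_secondCountable E
  have := Trajectory.polishSpace E
  have := Trajectory.borelSpace E
  have := D.isProbabilityMeasure_law
  have hU := hm.discUnif hc0 hc1
  have hUm := hU.cont.measurable
  have hb : IsBddPseudometric (D.G c m) :=
    { nonneg := fun _ _ => hU.transportCost_nonneg
      le_one := fun _ _ => hU.transportCost_le_one hUm
      self := fun _ => hU.transportCost_self hUm
      symm := fun _ _ => hU.transportCost_comm hUm
      triangle := fun _ _ _ => hU.transportCost_triangle hUm }
  refine ⟨hb, continuous_iff_continuousAt.2 fun p => ?_⟩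
  -- By the triangle inequality, joint continuity reduces to continuity at the diagonal in one
  -- variable, where weak continuity of the laws enters.
  have hlim : ∀ x, Tendsto (fun y => D.G c m y x) (𝓝 x) (𝓝 0) := fun x =>
    hU.tendsto_transportCost fun f => (D.weakly_continuous f).tendsto x
  have hsum : Tendsto (fun q : E × E => D.G c m q.1 p.1 + D.G c m q.2 p.2) (𝓝 p) (𝓝 0) := by
    have := ((hlim p.1).comp continuous_fst.continuousAt).add
      ((hlim p.2).comp continuous_snd.continuousAt)
    simpa using this
  refine tendsto_iff_dist_tendsto_zero.2 (squeeze_zero (fun _ => dist_nonneg) (fun q => ?_) hsum)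
  exact hb.abs_sub_le _ _ _ _

/-! ### The iteration and its supremum. -/

variable {obs : E → ℝ} (hobs : Continuous obs) (hobs01 : ∀ x, obs x ∈ Set.Icc (0 : ℝ) 1)
  (hc0 : 0 < c) (hc1 : c < 1)
include hobs hobs01 hc0 hc1

theorem isContPseudometric_dist (n : ℕ) : IsContPseudometric (D.dist c obs n) := by
  induction n with
  | zero =>
    exact
      { nonneg := fun _ _ => abs_nonneg _
        le_one := fun x y => abs_sub_le_iff.2
          ⟨by linarith [(hobs01 x).2, (hobs01 y).1], by linarith [(hobs01 x).1, (hobs01 y).2]⟩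
        self := fun x => by simp [Diffusion.dist]
        symm := fun x y => abs_sub_comm _ _
        triangle := fun x y z => abs_sub_le _ _ _
        cont := ((hobs.comp continuous_fst).sub (hobs.comp continuous_snd)).abs }
  | succ n ih => exact D.isContPseudometric_G ih hc0 hc1

theorem measurable_discUnif_dist (n : ℕ) :
    Measurable fun p : Trajectory E × Trajectory E => discUnif c (D.dist c obs n) p.1 p.2 := by
  have := polishSpace_of_locallyCompact_secondCountable E
  have := Trajectory.polishSpace E
  have := Trajectory.borelSpace E
  exact ((D.isContPseudometric_dist hobs hobs01 hc0 hc1 n).discUnif hc0 hc1).cont.measurable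

theorem monotone_dist (x y : E) : Monotone fun n => D.dist c obs n x y :=
  monotone_nat_of_le_succ fun n =>
    D.le_G (D.isContPseudometric_dist hobs hobs01 hc0 hc1 n).toIsBddPseudometric
      (D.measurable_discUnif_dist hobs hobs01 hc0 hc1 n) hc0 hc1 x y

theorem dist_le_distSup (n : ℕ) (x y : E) : D.dist c obs n x y ≤ D.distSup c obs x y :=
  le_ciSup (f := fun n => D.dist c obs n x y)
    ⟨1, by rintro _ ⟨n, rfl⟩; exact (D.isContPseudometric_dist hobs hobs01 hc0 hc1 n).le_one x y⟩ n

theorem isLscPseudometric_distSup : IsLscPseudometric (D.distSup c obs) := by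
  have hd := D.isContPseudometric_dist hobs hobs01 hc0 hc1
  refine
    { nonneg := fun x y => Real.iSup_nonneg fun n => (hd n).nonneg x y
      le_one := fun x y => ciSup_le fun n => (hd n).le_one x y
      self := fun x => by simp [Diffusion.distSup, (hd _).self]
      symm := fun x y => by simp only [Diffusion.distSup, (hd _).symm x y]
      triangle := fun x y z => ciSup_le fun n => ((hd n).triangle x y z).trans
        (add_le_add (D.dist_le_distSup hobs hobs01 hc0 hc1 n x y)
          (D.dist_le_distSup hobs hobs01 hc0 hc1 n y z))
      lsc := lowerSemicontinuous_ciSup (fun p => ⟨1, ?_⟩) fun n =>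
        (hd n).cont.lowerSemicontinuous }
  rintro _ ⟨n, rfl⟩
  exact (hd n).le_one p.1 p.2

theorem discUnif_dist_mono (ω ω' : Trajectory E) :
    Monotone fun n => discUnif c (D.dist c obs n) ω ω' := by
  have hd := fun n => (D.isContPseudometric_dist hobs hobs01 hc0 hc1 n).toIsBddPseudometric
  refine fun n n' hn => ciSup_le fun t => le_trans ?_ ((hd n').le_discUnif hc0 hc1 ω ω' t)
  exact mul_le_mul_of_nonneg_left (D.monotone_dist hobs hobs01 hc0 hc1 _ _ hn)
    (Real.rpow_nonneg hc0.le _)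

/-- Suprema over times and over indices commute, and multiplication by the nonnegative factor `c ^
t` respects suprema. -/
theorem discUnif_distSup (ω ω' : Trajectory E) :
    discUnif c (D.distSup c obs) ω ω' = ⨆ n, discUnif c (D.dist c obs n) ω ω' := by
  have hd := fun n => (D.isContPseudometric_dist hobs hobs01 hc0 hc1 n).toIsBddPseudometric
  have hs := (D.isLscPseudometric_distSup hobs hobs01 hc0 hc1).toIsBddPseudometric
  have hbdd : BddAbove (Set.range fun n => discUnif c (D.dist c obs n) ω ω') :=
    ⟨1, by rintro _ ⟨n, rfl⟩; exact ((hd n).discUnif hc0 hc1).le_one ω ω'⟩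
  refine le_antisymm (ciSup_le fun t => ?_) (ciSup_le fun n => ciSup_le fun t => ?_)
  · rw [Diffusion.distSup, Real.mul_iSup_of_nonneg (Real.rpow_nonneg hc0.le _)]
    exact ciSup_le fun n => ((hd n).le_discUnif hc0 hc1 ω ω' t).trans (le_ciSup hbdd n)
  · refine le_trans ?_ (hs.le_discUnif hc0 hc1 ω ω' t)
    exact mul_le_mul_of_nonneg_left (D.dist_le_distSup hobs hobs01 hc0 hc1 n _ _)
      (Real.rpow_nonneg hc0.le _)

theorem isFixedPt_distSup : Function.IsFixedPt (D.G c) (D.distSup c obs) := by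
  have := polishSpace_of_locallyCompact_secondCountable E
  have := Trajectory.polishSpace E
  have := Trajectory.borelSpace E
  have := D.isProbabilityMeasure_law
  have hd := D.isContPseudometric_dist hobs hobs01 hc0 hc1
  have hU := fun n => (hd n).discUnif hc0 hc1
  have hs := (D.isLscPseudometric_distSup hobs hobs01 hc0 hc1).toIsBddPseudometric
  have hsup : discUnif c (D.distSup c obs) =
      fun ω ω' => ⨆ n, discUnif c (D.dist c obs n) ω ω' := by
    ext ω ω'
    exact D.discUnif_distSup hobs hobs01 hc0 hc1 ω ω'
  funext x y
  refine le_antisymm ?_ (D.le_G hs ?_ hc0 hc1 x y)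
  -- The cost of the `n`-th discounted pseudometric is the iterate `n + 1`, which lies below the
  -- supremum.
  · rw [Diffusion.G, hsup]
    exact transportCost_iSup_le (fun n => (hU n).nonneg) (fun n => (hU n).le_one)
      (fun n => (hU n).cont) (D.discUnif_dist_mono hobs hobs01 hc0 hc1)
      fun n => D.dist_le_distSup hobs hobs01 hc0 hc1 (n + 1) x y
  -- The limit pseudometric need not be continuous; measurability comes from writing its discounted
  -- version as a countable supremum of continuous functions.
  · rw [hsup]
    exact Measurable.iSup fun n => D.measurable_discUnif_dist hobs hobs01 hc0 hc1 n

end Diffusion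

theorem mainTheorem7 {E : Type*} [TopologicalSpace E] [T2Space E] [LocallyCompactSpace E]
    [SecondCountableTopology E] [MeasurableSpace E] [BorelSpace E]
    (D : Diffusion E) (obs : E → ℝ) (hobs : Continuous obs)
    (hobs01 : ∀ x, obs x ∈ Set.Icc (0 : ℝ) 1) (c : ℝ) (hc0 : 0 < c) (hc1 : c < 1) :
    (∀ n, IsContPseudometric (D.dist c obs n)) ∧
      IsLscPseudometric (D.distSup c obs) ∧
      Function.IsFixedPt (D.G c) (D.distSup c obs) :=
  ⟨D.isContPseudometric_dist hobs hobs01 hc0 hc1, D.isLscPseudometric_distSup hobs hobs01 hc0 hc1,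
    D.isFixedPt_distSup hobs hobs01 hc0 hc1⟩
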